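/- Let $\Bbbk$ be a field of characteristic zero, and let $W_+$ be the positive Witt algebra, that is, the Lie algebra over $\Bbbk$ with basis $\{e_i : i \in \mathbb{Z}_{\ge 1}\}$ and Lie bracket $[e_i,e_j]=(j-i)\,e_{i+j}$. Equip the symmetric algebra $\mathrm{S}(W_+)$ with the Poisson bracket induced by the Lie bracket of $W_+$, i.e. the unique Poisson bracket with $\{x,y\}=[x,y]$ for $x,y\in W_+$. An ideal $I$ of $\mathrm{S}(W_+)$ is called Poisson if $\{a,b\}\in I$ for all $a\in \mathrm{S}(W_+)$ and $b\in I$, and radical if $I=\sqrt I$. Then $\mathrm{S}(W_+)$ satisfies the ascending chain condition on radical Poisson ideals: if $I_0\subseteq I_1\subseteq I_2\subseteq\cdots$ is an ascending sequence of ideals of $\mathrm{S}(W_+)$, each of which is both radical and Poisson, then there is $N$ such that $I_n=I_N$ for all $n\ge N$. -/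

import Mathlib

/-- A Poisson bracket on a commutative `R`-algebra `A`: an `R`-bilinear Lie bracket on `A` which is
a derivation in each argument. -/
class PoissonAlgebra (R A : Type*) [CommRing R] [CommRing A] [Algebra R A] where
  /-- The Poisson bracket `{a, b}`. -/
  bracket : A →ₗ[R] A →ₗ[R] A
  bracket_self : ∀ a, bracket a a = 0
  bracket_jacobi : ∀ a b c,
    bracket a (bracket b c) + bracket b (bracket c a) + bracket c (bracket a b) = 0
  bracket_mul : ∀ a b c, bracket a (b * c) = bracket a b * c + b * bracket a c

/-- An ideal `I` of a Poisson algebra `A` is a Poisson ideal if `{a, b} ∈ I` for all `a ∈ A` and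
`b ∈ I`. -/
def Ideal.IsPoisson (R : Type*) {A : Type*} [CommRing R] [CommRing A] [Algebra R A]
    [PoissonAlgebra R A] (I : Ideal A) : Prop :=
  ∀ a : A, ∀ b ∈ I, PoissonAlgebra.bracket (R := R) a b ∈ I

namespace SymmetricAlgebra

section Derivation

variable {R M : Type*} [CommRing R] [AddCommGroup M] [Module R M]

theorem derivation_eq_of_ι {D₁ D₂ : Derivation R (SymmetricAlgebra R M) (SymmetricAlgebra R M)}
    (h : ∀ x, D₁ (ι R M x) = D₂ (ι R M x)) : D₁ = D₂ := by
  ext a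
  induction a using SymmetricAlgebra.induction with
  | algebraMap r => simp
  | ι x => exact h x
  | mul a b ha hb => simp [ha, hb]
  | add a b ha hb => simp [ha, hb]

/-- The algebra map `a ↦ (a, D a)` to the dual numbers over the symmetric algebra, where `D` is the
derivation extending `f`. -/
noncomputable def dualLift (f : M →ₗ[R] SymmetricAlgebra R M) :
    SymmetricAlgebra R M →ₐ[R] TrivSqZeroExt (SymmetricAlgebra R M) (SymmetricAlgebra R M) :=
  lift
    { toFun := fun x => TrivSqZeroExt.inl (ι R M x) + TrivSqZeroExt.inr (f x)
      map_add' := fun x y => by ext <;> simp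
      map_smul' := fun r x => by ext <;> simp }

theorem dualLift_ι (f : M →ₗ[R] SymmetricAlgebra R M) (x : M) :
    dualLift f (ι R M x) = TrivSqZeroExt.inl (ι R M x) + TrivSqZeroExt.inr (f x) :=
  lift_ι_apply _ x

theorem fst_dualLift (f : M →ₗ[R] SymmetricAlgebra R M) (a : SymmetricAlgebra R M) :
    (dualLift f a).fst = a := by
  induction a using SymmetricAlgebra.induction with
  | algebraMap r => rw [AlgHom.commutes]; rfl
  | ι x => simp [dualLift_ι]
  | mul a b ha hb => simp [ha, hb]
  | add a b ha hb => simp [ha, hb]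

/-- The unique derivation of the symmetric algebra extending a linear map on generators. -/
noncomputable def liftDerivation (f : M →ₗ[R] SymmetricAlgebra R M) :
    Derivation R (SymmetricAlgebra R M) (SymmetricAlgebra R M) :=
  Derivation.mk'
    { toFun := fun a => (dualLift f a).snd
      map_add' := fun a b => by simp
      map_smul' := fun r a => by simp }
    (fun a b => by simp [fst_dualLift, mul_comm])

@[simp]
theorem liftDerivation_ι (f : M →ₗ[R] SymmetricAlgebra R M) (x : M) :
    liftDerivation f (ι R M x) = f x := by
  change (dualLift f (ι R M x)).snd = f x
  simp [dualLift_ι]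

end Derivation

section Poisson

variable {R L : Type*} [CommRing R] [LieRing L] [LieAlgebra R L]

/-- The adjoint action of `x ∈ L` on the symmetric algebra of `L`, by derivations. -/
noncomputable def adDerivation (x : L) :
    Derivation R (SymmetricAlgebra R L) (SymmetricAlgebra R L) :=
  liftDerivation (ι R L ∘ₗ (LieAlgebra.ad R L x : L →ₗ[R] L))

@[simp]
theorem adDerivation_ι (x y : L) : adDerivation (R := R) x (ι R L y) = ι R L ⁅x, y⁆ := by
  simp [adDerivation]

theorem adDerivation_add (x y : L) :
    adDerivation (R := R) (x + y) = adDerivation x + adDerivation y :=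
  derivation_eq_of_ι fun z => by simp

theorem adDerivation_smul (r : R) (x : L) :
    adDerivation (R := R) (r • x) = r • adDerivation x :=
  derivation_eq_of_ι fun z => by simp

/-- The Hamiltonian derivation `{a, ·}`: on generators it is `{a, y} = -(y · a)`, where `y · a` is
the adjoint action. -/
noncomputable def hamiltonian (a : SymmetricAlgebra R L) :
    Derivation R (SymmetricAlgebra R L) (SymmetricAlgebra R L) :=
  liftDerivation
    { toFun := fun y => -adDerivation y a
      map_add' := fun x y => by simp [adDerivation_add, add_comm]
      map_smul' := fun r x => by simp [adDerivation_smul] }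

@[simp]
theorem hamiltonian_ι_right (a : SymmetricAlgebra R L) (y : L) :
    hamiltonian a (ι R L y) = -adDerivation y a := by
  simp [hamiltonian]

theorem hamiltonian_ι (x : L) : hamiltonian (ι R L x) = adDerivation x :=
  derivation_eq_of_ι fun y => by
    rw [hamiltonian_ι_right, adDerivation_ι, adDerivation_ι, ← map_neg, lie_skew]

theorem hamiltonian_add (a b : SymmetricAlgebra R L) :
    hamiltonian (a + b) = hamiltonian a + hamiltonian b :=
  derivation_eq_of_ι fun y => by simp [add_comm]

theorem hamiltonian_smul (r : R) (a : SymmetricAlgebra R L) :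
    hamiltonian (r • a) = r • hamiltonian a :=
  derivation_eq_of_ι fun y => by simp

theorem hamiltonian_mul (a b : SymmetricAlgebra R L) :
    hamiltonian (a * b) = a • hamiltonian b + b • hamiltonian a :=
  derivation_eq_of_ι fun y => by simp [add_comm]

theorem hamiltonian_algebraMap (r : R) :
    hamiltonian (algebraMap R (SymmetricAlgebra R L) r) = 0 :=
  derivation_eq_of_ι fun y => by simp

theorem hamiltonian_skew (a b : SymmetricAlgebra R L) : hamiltonian a b = -hamiltonian b a := by
  induction b using SymmetricAlgebra.induction with
  | algebraMap r => simp [hamiltonian_algebraMap]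
  | ι y => rw [hamiltonian_ι_right, hamiltonian_ι]
  | mul b c hb hc => simp [hamiltonian_mul, hb, hc, add_comm]
  | add b c hb hc => simp [hamiltonian_add, hb, hc, add_comm]

theorem hamiltonian_self (a : SymmetricAlgebra R L) : hamiltonian a a = 0 := by
  induction a using SymmetricAlgebra.induction with
  | algebraMap r => simp
  | ι y => simp
  | mul a b ha hb =>
    rw [hamiltonian_mul]
    simp only [Derivation.add_apply, Derivation.smul_apply, Derivation.leibniz, ha, hb, smul_eq_mul]
    rw [hamiltonian_skew a b]; ring
  | add a b ha hb =>
    rw [hamiltonian_add]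
    simp only [Derivation.add_apply, map_add, ha, hb]
    rw [hamiltonian_skew a b]; ring

theorem hamiltonian_ι_lie (x y : L) :
    ⁅hamiltonian (ι R L x), hamiltonian (ι R L y)⁆ = hamiltonian (ι R L ⁅x, y⁆) :=
  derivation_eq_of_ι fun z => by
    simp [Derivation.commutator_apply, hamiltonian_ι, ← map_sub]

theorem ι_lie_hamiltonian (x : L) (b : SymmetricAlgebra R L) :
    ⁅hamiltonian (ι R L x), hamiltonian b⁆ = hamiltonian (hamiltonian (ι R L x) b) := by
  induction b using SymmetricAlgebra.induction with
  | algebraMap r =>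
    have h0 : hamiltonian (0 : SymmetricAlgebra R L) = 0 := by
      simpa using hamiltonian_algebraMap (R := R) (L := L) 0
    ext d
    rw [Derivation.commutator_apply, hamiltonian_algebraMap, Derivation.map_algebraMap, h0]
    simp
  | ι y => rw [hamiltonian_ι_lie, hamiltonian_ι x, adDerivation_ι]
  | mul b c hb hc =>
    ext d
    have h1 := Derivation.congr_fun hb d
    have h2 := Derivation.congr_fun hc d
    simp only [Derivation.commutator_apply] at h1 h2
    simp only [Derivation.commutator_apply, hamiltonian_mul, hamiltonian_add,
      Derivation.add_apply, Derivation.smul_apply, Derivation.leibniz, smul_eq_mul, map_add,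
      ← h1, ← h2]
    ring
  | add b c hb hc =>
    ext d
    have h1 := Derivation.congr_fun hb d
    have h2 := Derivation.congr_fun hc d
    simp only [Derivation.commutator_apply] at h1 h2
    simp only [Derivation.commutator_apply, hamiltonian_add, Derivation.add_apply, map_add,
      ← h1, ← h2]
    ring

theorem hamiltonian_lie (a b : SymmetricAlgebra R L) :
    ⁅hamiltonian a, hamiltonian b⁆ = hamiltonian (hamiltonian a b) :=
  derivation_eq_of_ι fun x => by
    have h := Derivation.congr_fun (ι_lie_hamiltonian x a) b
    rw [Derivation.commutator_apply] at h ⊢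
    rw [hamiltonian_skew b (ι R L x), hamiltonian_skew a (ι R L x),
      hamiltonian_skew (hamiltonian a b) (ι R L x), map_neg, map_neg,
      hamiltonian_skew b (hamiltonian (ι R L x) a), ← h]
    ring

/-- The Poisson structure on the symmetric algebra of a Lie algebra `L`: the unique Poisson bracket
with `{x, y} = [x, y]` for `x, y ∈ L`. -/
noncomputable instance instPoissonAlgebra : PoissonAlgebra R (SymmetricAlgebra R L) where
  bracket :=
    { toFun := fun a => (hamiltonian a).toLinearMap
      map_add' := fun a b => by rw [hamiltonian_add]; rfl
      map_smul' := fun r a => by rw [hamiltonian_smul]; rfl }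
  bracket_self a := hamiltonian_self a
  bracket_jacobi a b c := by
    change hamiltonian a (hamiltonian b c) + hamiltonian b (hamiltonian c a)
      + hamiltonian c (hamiltonian a b) = 0
    have h := Derivation.congr_fun (hamiltonian_lie a b) c
    rw [Derivation.commutator_apply] at h
    rw [hamiltonian_skew c (hamiltonian a b), ← h, hamiltonian_skew c a, map_neg]
    ring
  bracket_mul a b c := by
    change hamiltonian a (b * c) = hamiltonian a b * c + b * hamiltonian a c
    rw [Derivation.leibniz, smul_eq_mul, smul_eq_mul]
    ring

theorem poisson_bracket_ι (x y : L) :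
    PoissonAlgebra.bracket (R := R) (ι R L x) (ι R L y) = ι R L ⁅x, y⁆ := by
  change hamiltonian (ι R L x) (ι R L y) = _
  rw [hamiltonian_ι, adDerivation_ι]

end Poisson

end SymmetricAlgebra

/-- The underlying module of the positive Witt algebra over `k`: the free module with basis
`e i`, `i` a positive integer. -/
def PositiveWitt (k : Type*) [CommRing k] : Type _ := ℕ+ →₀ k

namespace PositiveWitt

variable {k : Type*} [CommRing k]

noncomputable instance : AddCommGroup (PositiveWitt k) := inferInstanceAs (AddCommGroup (ℕ+ →₀ k))

noncomputable instance : Module k (PositiveWitt k) := inferInstanceAs (Module k (ℕ+ →₀ k))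

variable (k) in
/-- The basis `e 1, e 2, e 3, …` of the positive Witt algebra. -/
noncomputable def e : Module.Basis ℕ+ k (PositiveWitt k) :=
  Module.Basis.ofRepr (LinearEquiv.refl k (ℕ+ →₀ k))

/-- The bilinear map with `[e i, e j] = (j - i) e (i + j)`. -/
noncomputable def lieBilin : PositiveWitt k →ₗ[k] PositiveWitt k →ₗ[k] PositiveWitt k :=
  (e k).constr k fun i => (e k).constr k fun j => (((j : ℕ) : k) - ((i : ℕ) : k)) • e k (i + j)

theorem lieBilin_e (i j : ℕ+) :
    lieBilin (e k i) (e k j) = (((j : ℕ) : k) - ((i : ℕ) : k)) • e k (i + j) := by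
  simp [lieBilin]

theorem lieBilin_skew (x y : PositiveWitt k) : lieBilin x y = -lieBilin y x := by
  have h : (lieBilin : PositiveWitt k →ₗ[k] _) = -lieBilin.flip :=
    (e k).ext fun i => (e k).ext fun j => by
      simp only [LinearMap.neg_apply, LinearMap.flip_apply, lieBilin_e]
      rw [add_comm j i, ← neg_smul, neg_sub]
  exact LinearMap.congr_fun₂ h x y

theorem span_induction {p : PositiveWitt k → Prop} (zero : p 0) (basis : ∀ i, p (e k i))
    (add : ∀ x y, p x → p y → p (x + y)) (smul : ∀ (r : k) x, p x → p (r • x))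
    (x : PositiveWitt k) : p x := by
  have hx : x ∈ Submodule.span k (Set.range (e k)) := by simp [(e k).span_eq]
  induction hx using Submodule.span_induction with
  | mem x hx => obtain ⟨i, rfl⟩ := hx; exact basis i
  | zero => exact zero
  | add x y _ _ hx hy => exact add x y hx hy
  | smul r x _ hx => exact smul r x hx

theorem lieBilin_self (x : PositiveWitt k) : lieBilin x x = 0 := by
  induction x using span_induction with
  | zero => simp
  | basis i => simp [lieBilin_e]
  | add x y hx hy =>
    simp only [map_add, LinearMap.add_apply, hx, hy, lieBilin_skew y x]
    abel
  | smul r x hx => simp [hx]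

theorem lieBilin_leibniz (x y z : PositiveWitt k) :
    lieBilin x (lieBilin y z) = lieBilin (lieBilin x y) z + lieBilin y (lieBilin x z) := by
  induction x using span_induction with
  | zero => simp
  | add x x' hx hx' => simp only [map_add, LinearMap.add_apply, hx, hx']; abel
  | smul r x hx => simp [hx]
  | basis i =>
    induction y using span_induction with
    | zero => simp
    | add y y' hy hy' => simp only [map_add, LinearMap.add_apply, hy, hy']; abel
    | smul r y hy => simp [hy]
    | basis j =>
      induction z using span_induction with
      | zero => simp
      | add z z' hz hz' => simp only [map_add, hz, hz']; abel
      | smul r z hz => simp [hz]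
      | basis l =>
        simp only [lieBilin_e, map_smul, LinearMap.smul_apply, smul_smul]
        rw [add_left_comm j i l, ← add_assoc i j l, ← add_smul]
        congr 1
        push_cast
        ring

noncomputable instance : LieRing (PositiveWitt k) where
  bracket x y := lieBilin x y
  add_lie x y z := by simp
  lie_add x y z := by simp
  lie_self x := lieBilin_self x
  leibniz_lie x y z := lieBilin_leibniz x y z

noncomputable instance : LieAlgebra k (PositiveWitt k) where
  lie_smul r x y := map_smul (lieBilin x) r y

theorem e_lie_e (i j : ℕ+) :
    ⁅e k i, e k j⁆ = (((j : ℕ) : k) - ((i : ℕ) : k)) • e k (i + j) :=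
  lieBilin_e i j

end PositiveWitt

/-! ### Radical Poisson ideals and their generators. -/

section PoissonRadical

variable {R A : Type*} [CommRing R] [CommRing A] [Algebra R A] [PoissonAlgebra R A]

/-! The proof follows the Ritt–Raudenbush basis theorem. Write {S} for the radical Poisson ideal
generated by S. It suffices that every radical Poisson ideal is contained in {F} for a finite subset
F of it. Otherwise Zorn's lemma gives a maximal counterexample M. Suppose some s ∉ M satisfies sM ⊆
{F} with F ⊆ M finite. By maximality {M, s} is finitely generated up to radicals, and the product
rule `mul_mem_of_mem_poissonRadical` transfers this to M, a contradiction.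

To find s, take f ≠ 0 of least degree in M, let n be its largest variable index and put s = ∂f/∂xₙ,
which is nonzero of smaller degree, hence outside M. Since {xᵢ, f} = (n - i) xᵢ₊ₙ s + (terms in
variables of index below i + n) for i > n, inverting s modulo a Poisson ideal containing f expresses
every generator through x₁, …, x₂ₙ (`fractionClosure_eq_top`). Hilbert's basis theorem in these 2n
variables then supplies F (`exists_finset_mul_mem`). -/

theorem Ideal.IsPoisson.comap_mul {J : Ideal A} (hr : J.IsRadical) (hp : J.IsPoisson R) (a : A) :
    Ideal.IsPoisson R (Submodule.comap (LinearMap.lsmul A A a) J) := by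
  intro d x hx
  simp only [Submodule.mem_comap, LinearMap.lsmul_apply, smul_eq_mul] at hx ⊢
  have h := hp d _ hx
  rw [PoissonAlgebra.bracket_mul] at h
  refine hr ⟨2, ?_⟩
  set y := PoissonAlgebra.bracket (R := R) d x
  set b := PoissonAlgebra.bracket (R := R) d a
  -- Both `a * x` and its bracket with `d`, namely `b * x + a * y`, lie in `J`; only the square of
  -- `a * y` is reached, so radicality is essential.
  have e : (a * y) ^ 2 = (a * y) * (b * x + a * y) - (y * b) * (a * x) := by ring
  rw [e]
  exact J.sub_mem (J.mul_mem_left _ h) (J.mul_mem_left _ hx)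

theorem Ideal.IsRadical.comap_mul {J : Ideal A} (hr : J.IsRadical) (a : A) :
    Ideal.IsRadical (Submodule.comap (LinearMap.lsmul A A a) J) := by
  rintro x ⟨n, hx⟩
  simp only [Submodule.mem_comap, LinearMap.lsmul_apply, smul_eq_mul] at hx ⊢
  refine hr ⟨n + 1, ?_⟩
  rw [show (a * x) ^ (n + 1) = (a ^ n * x) * (a * x ^ n) by ring]
  exact J.mul_mem_left _ hx

variable (R) in
/-- The smallest radical Poisson ideal containing a set. -/
def poissonRadical (S : Set A) : Ideal A :=
  sInf {J | S ⊆ J ∧ J.IsRadical ∧ J.IsPoisson R}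

theorem mem_poissonRadical {S : Set A} {x : A} :
    x ∈ poissonRadical R S ↔ ∀ J : Ideal A, S ⊆ J → J.IsRadical → J.IsPoisson R → x ∈ J := by
  simp [poissonRadical, Submodule.mem_sInf]

theorem subset_poissonRadical (S : Set A) : S ⊆ poissonRadical R S := fun _ hx =>
  mem_poissonRadical.2 fun _ hJ _ _ => hJ hx

theorem poissonRadical_le {S : Set A} {J : Ideal A} (hS : S ⊆ J) (hr : J.IsRadical)
    (hp : J.IsPoisson R) : poissonRadical R S ≤ J := fun _ hx =>
  mem_poissonRadical.1 hx J hS hr hp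

theorem isRadical_poissonRadical (S : Set A) : (poissonRadical R S).IsRadical := by
  rintro x ⟨n, hx⟩
  exact mem_poissonRadical.2 fun J hS hr hp => hr ⟨n, mem_poissonRadical.1 hx J hS hr hp⟩

theorem isPoisson_poissonRadical (S : Set A) : (poissonRadical R S).IsPoisson R := fun a _ hx =>
  mem_poissonRadical.2 fun J hS hr hp => hp a _ (mem_poissonRadical.1 hx J hS hr hp)

theorem poissonRadical_mono {S T : Set A} (h : S ⊆ T) : poissonRadical R S ≤ poissonRadical R T :=
  poissonRadical_le (h.trans (subset_poissonRadical T)) (isRadical_poissonRadical T)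
    (isPoisson_poissonRadical T)

/-- Colon ideals of `J` are again radical and Poisson, so one factor at a time can be extended from
generators to the whole generated ideal. -/
theorem mul_mem_of_mem_poissonRadical {S T : Set A} {J : Ideal A} (hr : J.IsRadical)
    (hp : J.IsPoisson R) (h : ∀ s ∈ S, ∀ t ∈ T, s * t ∈ J) {x y : A}
    (hx : x ∈ poissonRadical R S) (hy : y ∈ poissonRadical R T) : x * y ∈ J := by
  have h1 : ∀ s ∈ S, s * y ∈ J := fun s hs =>
    poissonRadical_le (J := Submodule.comap (LinearMap.lsmul A A s) J) (h s hs)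
      (hr.comap_mul s) (hp.comap_mul hr s) hy
  rw [mul_comm]
  exact poissonRadical_le (J := Submodule.comap (LinearMap.lsmul A A y) J)
    (fun s hs => by simpa [mul_comm] using h1 s hs) (hr.comap_mul y) (hp.comap_mul hr y) hx

/-- The union of the ideals generated by finite subsets of `S` is already a radical Poisson ideal.
-/
theorem exists_finset_mem_poissonRadical {S : Set A} {x : A} (hx : x ∈ poissonRadical R S) :
    ∃ F : Finset A, ↑F ⊆ S ∧ x ∈ poissonRadical R (F : Set A) := by
  classical
  let J : Ideal A :=
    { carrier := {x | ∃ F : Finset A, ↑F ⊆ S ∧ x ∈ poissonRadical R (F : Set A)}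
      zero_mem' := ⟨∅, by simp, Ideal.zero_mem _⟩
      add_mem' := by
        rintro a b ⟨F, hF, ha⟩ ⟨G, hG, hb⟩
        exact ⟨F ∪ G, by simp [hF, hG], Ideal.add_mem _ (poissonRadical_mono (by simp) ha)
          (poissonRadical_mono (by simp) hb)⟩
      smul_mem' := by
        rintro c a ⟨F, hF, ha⟩
        exact ⟨F, hF, Ideal.mul_mem_left _ _ ha⟩ }
  refine poissonRadical_le (J := J) (fun s hs => ⟨{s}, by simpa, ?_⟩) ?_ ?_ hx
  · exact subset_poissonRadical _ (by simp)
  · rintro a ⟨n, F, hF, ha⟩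
    exact ⟨F, hF, isRadical_poissonRadical _ ⟨n, ha⟩⟩
  · rintro a b ⟨F, hF, hb⟩
    exact ⟨F, hF, isPoisson_poissonRadical _ a b hb⟩

theorem exists_finset_subset_poissonRadical {S : Set A} (G : Finset A)
    (hG : ↑G ⊆ (poissonRadical R S : Set A)) :
    ∃ F : Finset A, ↑F ⊆ S ∧ ↑G ⊆ (poissonRadical R (F : Set A) : Set A) := by
  classical
  choose! F hF hG' using fun x (hx : x ∈ G) => exists_finset_mem_poissonRadical (hG hx)
  refine ⟨G.biUnion F, by simpa using hF, fun x hx => ?_⟩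
  refine poissonRadical_mono ?_ (hG' x hx)
  exact_mod_cast Finset.subset_biUnion_of_mem F hx

variable (R) in
/-- A Poisson ideal is finitely generated up to radicals if it lies in the radical Poisson ideal
generated by finitely many of its elements. -/
def Ideal.IsPoissonRadicalFG (P : Ideal A) : Prop :=
  ∃ F : Finset A, (F : Set A) ⊆ P ∧ P ≤ poissonRadical R (F : Set A)

theorem Ideal.isPoissonRadicalFG_of_mul_mem {P : Ideal A} {s : A} {F : Finset A}
    (hFP : (F : Set A) ⊆ P) (hF : ∀ p ∈ P, s * p ∈ poissonRadical R (F : Set A))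
    (hs : (poissonRadical R (insert s (P : Set A))).IsPoissonRadicalFG R) :
    P.IsPoissonRadicalFG R := by
  classical
  obtain ⟨G, hG, hPG⟩ := hs
  obtain ⟨H, hH, hGH⟩ := exists_finset_subset_poissonRadical G hG
  refine ⟨F ∪ H.erase s, ?_, fun p hp => ?_⟩
  · intro x hx
    simp only [Finset.coe_union, Finset.coe_erase, Set.mem_union, Set.mem_sdiff,
      Set.mem_singleton_iff] at hx
    rcases hx with hx | ⟨hx, hxs⟩
    · exact hFP hx
    · exact (hH hx).resolve_left hxs
  · have hr := isRadical_poissonRadical (R := R) ((F ∪ H.erase s : Finset A) : Set A)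
    have hpH : p ∈ poissonRadical R (H : Set A) :=
      poissonRadical_le hGH (isRadical_poissonRadical _) (isPoisson_poissonRadical _)
        (hPG (subset_poissonRadical _ (Set.mem_insert_of_mem _ hp)))
    have hpP : p ∈ poissonRadical R (P : Set A) := subset_poissonRadical _ hp
    -- View one factor of `p * p` in the ideal generated by `P` and the other in that generated by
    -- `H`. Only products `q * t` with `q ∈ P`, `t ∈ H` remain: `t = s` is covered by `hF`, and any
    -- other `t` is a chosen generator.
    refine hr ⟨2, ?_⟩
    rw [pow_two]
    refine mul_mem_of_mem_poissonRadical hr (isPoisson_poissonRadical _) ?_ hpP hpH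
    intro q hq t ht
    by_cases hts : t = s
    · subst hts
      rw [mul_comm]
      exact poissonRadical_mono (by simp) (hF q hq)
    · exact Ideal.mul_mem_left _ _ (subset_poissonRadical _ (by simp [hts, Finset.mem_coe.1 ht]))

/-- If every radical Poisson ideal `P` that is not finitely generated up to radicals has an element
`s ∉ P` such that `s P` is finitely generated up to radicals, then there is no such `P`. -/
theorem Ideal.isPoissonRadicalFG_of_forall_exists
    (h : ∀ P : Ideal A, P.IsRadical → P.IsPoisson R → ¬ P.IsPoissonRadicalFG R →
      ∃ s ∉ P, ∃ F : Finset A, (F : Set A) ⊆ P ∧ ∀ p ∈ P, s * p ∈ poissonRadical R (F : Set A))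
    (P : Ideal A) (hr : P.IsRadical) (hp : P.IsPoisson R) : P.IsPoissonRadicalFG R := by
  by_contra hP
  obtain ⟨M, -, hM⟩ := zorn_le_nonempty₀
    {Q : Ideal A | Q.IsRadical ∧ Q.IsPoisson R ∧ ¬ Q.IsPoissonRadicalFG R} (by
      intro c hc hchain y hy
      have mem : ∀ x, x ∈ sSup c ↔ ∃ Q ∈ c, x ∈ Q := fun x =>
        Submodule.mem_sSup_of_directed ⟨y, hy⟩ hchain.directedOn
      refine ⟨sSup c, ⟨?_, ?_, ?_⟩, fun z hz => le_sSup hz⟩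
      · rintro x ⟨n, hx⟩
        obtain ⟨Q, hQ, hx⟩ := (mem _).1 hx
        exact (mem _).2 ⟨Q, hQ, (hc hQ).1 ⟨n, hx⟩⟩
      · intro a x hx
        obtain ⟨Q, hQ, hx⟩ := (mem _).1 hx
        exact (mem _).2 ⟨Q, hQ, (hc hQ).2.1 a x hx⟩
      · rintro ⟨F, hF, hle⟩
        have : ∃ Q ∈ c, (F : Set A) ⊆ Q :=
          DirectedOn.exists_mem_subset_of_finset_subset_biUnion (f := fun Q : Ideal A => (Q : Set A))
            ⟨y, hy⟩ hchain.directedOn fun x hx => by simpa using (mem x).1 (hF hx)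
        obtain ⟨Q, hQ, hFQ⟩ := this
        exact (hc hQ).2.2 ⟨F, hFQ, (le_sSup hQ).trans hle⟩) P ⟨hr, hp, hP⟩
  obtain ⟨hMr, hMp, hMfg⟩ := hM.prop
  obtain ⟨s, hs, F, hFM, hF⟩ := h M hMr hMp hMfg
  -- If adjoining `s` to `M` gave another counterexample, maximality would force `s ∈ M`.
  refine hMfg (Ideal.isPoissonRadicalFG_of_mul_mem hFM hF (by_contra fun hN => hs ?_))
  exact hM.le_of_ge ⟨isRadical_poissonRadical _, isPoisson_poissonRadical _, hN⟩
    (fun x hx => subset_poissonRadical (R := R) _ (Set.mem_insert_of_mem s hx))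
    (subset_poissonRadical _ (Set.mem_insert s _))

theorem exists_forall_eq_of_isPoissonRadicalFG
    (h : ∀ P : Ideal A, P.IsRadical → P.IsPoisson R → P.IsPoissonRadicalFG R)
    {I : ℕ → Ideal A} (hI : Monotone I) (hrad : ∀ n, (I n).IsRadical)
    (hpoisson : ∀ n, (I n).IsPoisson R) : ∃ N, ∀ n, N ≤ n → I n = I N := by
  have mem : ∀ x, x ∈ iSup I ↔ ∃ n, x ∈ I n := fun x =>
    Submodule.mem_iSup_of_directed _ hI.directed_le
  obtain ⟨F, hF, hle⟩ := h (iSup I)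
    (by
      rintro x ⟨m, hx⟩
      obtain ⟨n, hn⟩ := (mem _).1 hx
      exact (mem _).2 ⟨n, hrad n ⟨m, hn⟩⟩)
    (fun a x hx => by
      obtain ⟨n, hn⟩ := (mem _).1 hx
      exact (mem _).2 ⟨n, hpoisson n a x hn⟩)
  choose! g hg using fun x (hx : x ∈ F) => (mem x).1 (hF hx)
  refine ⟨F.sup g, fun n hn => le_antisymm ?_ (hI hn)⟩
  exact (le_iSup I n).trans (hle.trans (poissonRadical_le
    (fun x hx => hI (Finset.le_sup hx) (hg x hx)) (hrad _) (hpoisson _)))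

end PoissonRadical

/-! ### Degree and nonvanishing of partial derivatives. -/

namespace MvPolynomial

variable {σ R : Type*} [CommRing R]

theorem totalDegree_pderiv_lt {i : σ} {p : MvPolynomial σ R} (hp : pderiv i p ≠ 0) :
    (pderiv i p).totalDegree < p.totalDegree := by
  classical
  have key : ∀ m ∈ (pderiv i p).support, (m.sum fun _ n => n) + 1 ≤ p.totalDegree := by
    intro m hm
    rw [mem_support_iff, coeff_pderiv] at hm
    have h := le_totalDegree (mem_support_iff.2 (left_ne_zero_of_mul hm))
    rwa [Finsupp.sum_add_index' (by simp) (by simp), Finsupp.sum_single_index rfl] at h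
  obtain ⟨m, hm⟩ := support_nonempty.2 hp
  rw [totalDegree, Finset.sup_lt_iff (by have := key m hm; exact bot_lt_iff_ne_bot.2 (by
    simp only [bot_eq_zero']; omega))]
  exact fun m hm => key m hm

theorem pderiv_ne_zero [NoZeroDivisors R] [CharZero R] {i : σ} {p : MvPolynomial σ R}
    (hi : i ∈ p.vars) : pderiv i p ≠ 0 := by
  classical
  obtain ⟨d, hd, hid⟩ := (mem_vars_iff_mem_support i).1 hi
  intro h
  have hc := coeff_pderiv (i := i) p (d - Finsupp.single i 1)
  rw [Finsupp.sub_add_single_one_cancel (Finsupp.mem_support_iff.1 hid), h, coeff_zero] at hc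
  rcases mul_eq_zero.1 hc.symm with h1 | h1
  · exact mem_support_iff.1 hd h1
  · exact Nat.cast_add_one_ne_zero _ h1

end MvPolynomial

/-! ### Elements expressible over a subalgebra after inverting `s` modulo an ideal. -/

section FractionClosure

variable {R A : Type*} [CommRing R] [CommRing A] [Algebra R A]

/-- The elements that lie in `B` modulo `T` after multiplication by a power of `s`. -/
def fractionClosure (B : Subalgebra R A) (T : Ideal A) (s : A) (hs : s ∈ B) :
    Subalgebra R A where
  carrier := {a | ∃ m : ℕ, ∃ b ∈ B, s ^ m * a - b ∈ T}
  algebraMap_mem' r := ⟨0, _, B.algebraMap_mem r, by simp⟩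
  add_mem' := by
    rintro a a' ⟨m, b, hb, h⟩ ⟨m', b', hb', h'⟩
    refine ⟨m + m', s ^ m' * b + s ^ m * b',
      add_mem (mul_mem (pow_mem hs _) hb) (mul_mem (pow_mem hs _) hb'), ?_⟩
    convert T.add_mem (T.mul_mem_left (s ^ m') h) (T.mul_mem_left (s ^ m) h') using 1
    ring
  mul_mem' := by
    rintro a a' ⟨m, b, hb, h⟩ ⟨m', b', hb', h'⟩
    refine ⟨m + m', b * b', mul_mem hb hb', ?_⟩
    convert T.add_mem (T.mul_mem_left (s ^ m' * a') h) (T.mul_mem_left b h') using 1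
    ring

variable {B : Subalgebra R A} {T : Ideal A} {s : A} {hs : s ∈ B}

theorem mem_fractionClosure_of_mem {a : A} (ha : a ∈ B) : a ∈ fractionClosure B T s hs :=
  ⟨0, a, ha, by simp⟩

theorem mem_fractionClosure_of_mem_ideal {a : A} (ha : a ∈ T) : a ∈ fractionClosure B T s hs :=
  ⟨0, 0, zero_mem _, by simpa⟩

theorem mem_fractionClosure_of_mul_mem {a : A} (ha : s * a ∈ fractionClosure B T s hs) :
    a ∈ fractionClosure B T s hs := by
  obtain ⟨m, b, hb, h⟩ := ha
  exact ⟨m + 1, b, hb, by rwa [pow_succ, mul_assoc]⟩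

end FractionClosure

/-! ### Truncations, partial derivatives and elimination in the symmetric algebra of the Witt
algebra. -/

namespace PositiveWitt

open SymmetricAlgebra

variable {k : Type*} [Field k]

local notation "SW" => SymmetricAlgebra k (PositiveWitt k)

variable (k) in
/-- The generator of the symmetric algebra attached to the basis vector `e i`. -/
noncomputable def x (i : ℕ+) : SymmetricAlgebra k (PositiveWitt k) := ι k (PositiveWitt k) (e k i)

variable (k) in
/-- The partial derivative with respect to the generator `x i`. -/
noncomputable def partialDeriv (i : ℕ+) : Derivation k SW SW :=
  liftDerivation (Algebra.linearMap k SW ∘ₗ (e k).coord i)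

theorem partialDeriv_x (i j : ℕ+) : partialDeriv k i (x k j) = if j = i then 1 else 0 := by
  simp [partialDeriv, x, Finsupp.single_apply, apply_ite]

theorem hamiltonian_x (i j : ℕ+) :
    hamiltonian (x k i) (x k j) = (((j : ℕ) : k) - ((i : ℕ) : k)) • x k (i + j) := by
  rw [x, x, hamiltonian_ι, adDerivation_ι, e_lie_e, map_smul, x]

variable (k) in
/-- The subalgebra generated by `x 1, …, x n`. -/
noncomputable def truncation (n : ℕ+) : Subalgebra k SW := Algebra.adjoin k (x k '' Set.Iic n)

theorem x_mem_truncation {i n : ℕ+} (h : i ≤ n) : x k i ∈ truncation k n :=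
  Algebra.subset_adjoin ⟨i, h, rfl⟩

theorem truncation_mono {m n : ℕ+} (h : m ≤ n) : truncation k m ≤ truncation k n :=
  Algebra.adjoin_mono (Set.image_mono (Set.Iic_subset_Iic.2 h))

instance (n : ℕ+) : IsNoetherianRing (truncation k n) := by
  have : Algebra.FiniteType k (truncation k n) :=
    (Subalgebra.fg_iff_finiteType _).1
      (Subalgebra.fg_def.2 ⟨_, (Set.finite_Iic n).image (x k), rfl⟩)
  exact Algebra.FiniteType.isNoetherianRing k _

theorem partialDeriv_mem_truncation {n : ℕ+} (i : ℕ+) {f : SW} (hf : f ∈ truncation k n) :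
    partialDeriv k i f ∈ truncation k n := by
  induction hf using Algebra.adjoin_induction with
  | mem f hf =>
    obtain ⟨j, -, rfl⟩ := hf
    rw [partialDeriv_x]
    split_ifs
    · exact one_mem _
    · exact zero_mem _
  | algebraMap r => simp [zero_mem]
  | add f g _ _ hf hg => rw [map_add]; exact add_mem hf hg
  | mul f g hf' hg' hf hg =>
    rw [Derivation.leibniz]
    exact add_mem (mul_mem hf' hg) (mul_mem hg' hf)

theorem eq_top_of_x_mem {B : Subalgebra k SW} (h : ∀ i, x k i ∈ B) : B = ⊤ := by
  rw [Algebra.eq_top_iff]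
  intro a
  induction a using SymmetricAlgebra.induction with
  | algebraMap r => exact B.algebraMap_mem r
  | ι y =>
    induction y using span_induction with
    | zero => rw [map_zero]; exact zero_mem _
    | basis i => exact h i
    | add y z hy hz => rw [map_add]; exact add_mem hy hz
    | smul r y hy => rw [map_smul]; exact B.smul_mem hy r
  | mul a b ha hb => exact mul_mem ha hb
  | add a b ha hb => exact add_mem ha hb

/-- The Hamiltonian derivation of `x i` on `k[x 1, …, x n]` agrees with `{x i, x n} ∂ₙ` up to terms
involving only `x 1, …, x n` and the generators `x (i + j)` with `j < n`. -/
theorem hamiltonian_sub_mem {C : Subalgebra k SW} {i n : ℕ+} (hn : truncation k n ≤ C)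
    (hC : ∀ j < n, x k (i + j) ∈ C) {f : SW} (hf : f ∈ truncation k n) :
    hamiltonian (x k i) f - hamiltonian (x k i) (x k n) * partialDeriv k n f ∈ C := by
  induction hf using Algebra.adjoin_induction with
  | mem f hf =>
    obtain ⟨j, hj, rfl⟩ := hf
    rw [partialDeriv_x]
    split_ifs with h
    · simp [h, zero_mem]
    · rw [mul_zero, sub_zero, hamiltonian_x]
      exact C.smul_mem (hC j (lt_of_le_of_ne hj h)) _
  | algebraMap r => simp [zero_mem]
  | add f g _ _ hf hg =>
    simp only [map_add, mul_add]
    rw [add_sub_add_comm]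
    exact add_mem hf hg
  | mul f g hf' hg' hf hg =>
    convert add_mem (mul_mem (hn hf') hg) (mul_mem (hn hg') hf) using 1
    simp only [Derivation.leibniz, smul_eq_mul]
    ring

theorem equivMvPolynomial_partialDeriv (n : ℕ+) (f : SW) :
    equivMvPolynomial (e k) (partialDeriv k n f) =
      MvPolynomial.pderiv n (equivMvPolynomial (e k) f) := by
  have hx : f ∈ (⊤ : Subalgebra k SW) := trivial
  have htop : Algebra.adjoin k (Set.range (x k)) = ⊤ :=
    eq_top_of_x_mem fun i => Algebra.subset_adjoin ⟨i, rfl⟩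
  rw [← htop] at hx
  induction hx using Algebra.adjoin_induction with
  | mem f hf =>
    obtain ⟨j, rfl⟩ := hf
    rw [partialDeriv_x, x, equivMvPolynomial_ι_apply, MvPolynomial.pderiv_X, Pi.single_apply]
    split_ifs <;> simp
  | algebraMap r => simp
  | add f g _ _ hf hg => simp [hf, hg]
  | mul f g _ _ hf hg => simp [hf, hg]

theorem mem_truncation {n : ℕ+} {f : SW}
    (hf : ∀ i ∈ (equivMvPolynomial (e k) f).vars, i ≤ n) : f ∈ truncation k n := by
  have h : equivMvPolynomial (e k) f ∈ MvPolynomial.supported k (Set.Iic n) :=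
    MvPolynomial.mem_supported.2 hf
  have h' : f ∈ ((MvPolynomial.supported k (Set.Iic n)).map
      (equivMvPolynomial (e k)).symm.toAlgHom) := ⟨_, h, by simp⟩
  rw [MvPolynomial.supported_eq_adjoin_X, AlgHom.map_adjoin, ← Set.image_comp] at h'
  have hX : ⇑(equivMvPolynomial (e k)).symm.toAlgHom ∘ MvPolynomial.X = x k :=
    funext fun i => equivMvPolynomial_symm_X (e k) i
  rwa [hX] at h'

variable [CharZero k]

theorem fractionClosure_eq_top {n : ℕ+} {f : SW} (hf : f ∈ truncation k n) {T : Ideal SW}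
    (hT : T.IsPoisson k) (hfT : f ∈ T)
    (hs : partialDeriv k n f ∈ truncation k (n + n)) :
    fractionClosure (truncation k (n + n)) T (partialDeriv k n f) hs = ⊤ := by
  set C := fractionClosure (truncation k (n + n)) T (partialDeriv k n f) hs
  have hle : truncation k (n + n) ≤ C := fun a ha => mem_fractionClosure_of_mem ha
  refine eq_top_of_x_mem fun m => ?_
  induction m using PNat.strongInductionOn with
  | _ m ih =>
    rcases le_or_gt m (n + n) with h | h
    · exact hle (x_mem_truncation h)
    -- Bracketing `f` with `x i` for `i = m - n` gives `x m` the coefficient `n - i` times the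
    -- derivative. The bound `m > 2n` yields `i > n`, so this scalar is nonzero in characteristic
    -- zero, and the other new generators `x (i + j)`, `j < n`, have index below `m`.
    · obtain ⟨i, rfl⟩ : ∃ i, m = i + n :=
        ⟨m - n, (PNat.sub_add_of_lt ((PNat.lt_add_right n n).trans h)).symm⟩
      have hni : n < i := lt_of_add_lt_add_right h
      have h1 := hamiltonian_sub_mem (C := C) (i := i)
        ((truncation_mono (PNat.lt_add_right n n).le).trans hle)
        (fun j hj => ih _ (add_lt_add_right hj i)) hf
      have h2 : hamiltonian (x k i) f ∈ C := mem_fractionClosure_of_mem_ideal (hT _ _ hfT)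
      have h3 := sub_mem h2 h1
      rw [sub_sub_cancel, hamiltonian_x, smul_mul_assoc] at h3
      have hc : ((n : ℕ) : k) - ((i : ℕ) : k) ≠ 0 :=
        sub_ne_zero.2 fun h => hni.ne (PNat.coe_injective (Nat.cast_injective h))
      have h4 := C.smul_mem h3 (((n : ℕ) : k) - ((i : ℕ) : k))⁻¹
      rw [inv_smul_smul₀ hc, mul_comm] at h4
      exact mem_fractionClosure_of_mul_mem h4

theorem exists_finset_mul_mem {P : Ideal SW} (hr : P.IsRadical) (hp : P.IsPoisson k) {n : ℕ+}
    {f : SW} (hf : f ∈ truncation k n) (hfP : f ∈ P) :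
    ∃ F : Finset SW, (F : Set SW) ⊆ P ∧
      ∀ p ∈ P, partialDeriv k n f * p ∈ poissonRadical k (F : Set SW) := by
  classical
  set B := truncation k (n + n)
  obtain ⟨G, hG⟩ := IsNoetherian.noetherian (P.comap B.val)
  have hs : partialDeriv k n f ∈ B :=
    truncation_mono (PNat.lt_add_right n n).le (partialDeriv_mem_truncation n hf)
  let F : Finset SW := insert f (G.image B.val)
  have hFP : (F : Set SW) ⊆ P := by
    intro a ha
    rcases Finset.mem_insert.1 (Finset.mem_coe.1 ha) with rfl | ha
    · exact hfP
    · obtain ⟨g, hg, rfl⟩ := Finset.mem_image.1 ha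
      have : g ∈ P.comap B.val := hG ▸ Submodule.subset_span hg
      exact this
  refine ⟨F, hFP, fun p hpP => ?_⟩
  set T := poissonRadical k (F : Set SW)
  have hGT : P.comap B.val ≤ T.comap B.val := by
    rw [← hG, Submodule.span_le]
    exact fun g hg => subset_poissonRadical (F : Set SW)
      (Finset.mem_insert_of_mem (Finset.mem_image_of_mem _ hg))
  have htop := fractionClosure_eq_top hf (isPoisson_poissonRadical (F : Set SW))
    (subset_poissonRadical _ (Finset.mem_insert_self f _)) hs
  obtain ⟨m, b, hb, hmb⟩ := Algebra.eq_top_iff.1 htop p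
  -- As `P` is radical and Poisson, it contains `T`, so the congruence modulo `T` also holds modulo
  -- `P`.
  have hbP : b ∈ P := by
    have := P.sub_mem (P.mul_mem_left (partialDeriv k n f ^ m) hpP)
      (poissonRadical_le hFP hr hp hmb)
    rwa [sub_sub_cancel] at this
  have hbT : b ∈ T := hGT (x := ⟨b, hb⟩) hbP
  -- With `s` the derivative, `s ^ m * p ∈ T`, and `(s * p) ^ (m + 1) = (s * p ^ m) * (s ^ m * p)`.
  refine isRadical_poissonRadical _ ⟨m + 1, ?_⟩
  have := T.mul_mem_left (partialDeriv k n f * p ^ m) (T.add_mem hmb hbT)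
  rw [sub_add_cancel] at this
  convert this using 1
  ring

/-- A nonzero element of least total degree in `P` is not constant because `P` is proper; its
derivative in its largest variable is nonzero of lower degree, so minimality keeps it out of `P`. -/
theorem exists_partialDeriv_notMem {P : Ideal SW} (h0 : P ≠ ⊥) (h1 : P ≠ ⊤) :
    ∃ (n : ℕ+) (f : SW), f ∈ truncation k n ∧ f ∈ P ∧ partialDeriv k n f ∉ P := by
  classical
  set φ := equivMvPolynomial (e k)
  obtain ⟨g, hgP, hg0⟩ := Submodule.exists_mem_ne_zero_of_ne_bot h0
  obtain ⟨f, ⟨hfP, hf0⟩, hmin⟩ := WellFounded.has_min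
    (InvImage.wf (fun f : SW => (φ f).totalDegree) wellFounded_lt)
    {f | f ∈ P ∧ f ≠ 0} ⟨g, hgP, hg0⟩
  have hvars : (φ f).vars.Nonempty := by
    rw [Finset.nonempty_iff_ne_empty]
    intro h
    have hC := MvPolynomial.vars_eq_empty_iff_eq_C.1 h
    set c := (φ f).coeff 0
    have hfc : f = algebraMap k SW c := by
      apply φ.injective
      rw [AlgEquiv.commutes, hC, MvPolynomial.algebraMap_eq]
    have hc : c ≠ 0 := by
      rintro hc
      exact hf0 (by rw [hfc, hc, map_zero])
    exact h1 (Ideal.eq_top_of_isUnit_mem _ (hfc ▸ hfP) ((IsUnit.mk0 c hc).map _))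
  have hn := Finset.max'_mem _ hvars
  refine ⟨(φ f).vars.max' hvars, f, mem_truncation fun i hi => Finset.le_max' _ _ hi, hfP,
    fun hd => ?_⟩
  have hne := MvPolynomial.pderiv_ne_zero hn
  have hlt := MvPolynomial.totalDegree_pderiv_lt hne
  rw [← equivMvPolynomial_partialDeriv] at hne hlt
  exact hmin _ ⟨hd, fun h => hne (by rw [h, map_zero])⟩ hlt

theorem isPoissonRadicalFG {P : Ideal SW} (hr : P.IsRadical) (hp : P.IsPoisson k) :
    P.IsPoissonRadicalFG k := by
  refine Ideal.isPoissonRadicalFG_of_forall_exists (fun Q hQr hQp hQ => ?_) P hr hp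
  have h0 : Q ≠ ⊥ := by
    rintro rfl
    exact hQ ⟨∅, by simp, bot_le⟩
  have h1 : Q ≠ ⊤ := by
    rintro rfl
    refine hQ ⟨{1}, by simp, ?_⟩
    rw [(Ideal.eq_top_iff_one _).2 (subset_poissonRadical _ (by simp))]
  obtain ⟨n, f, hf, hfQ, hs⟩ := exists_partialDeriv_notMem h0 h1
  exact ⟨_, hs, exists_finset_mul_mem hQr hQp hf hfQ⟩

end PositiveWitt

theorem theorem2p13 {k : Type*} [Field k] [CharZero k]
    (I : ℕ → Ideal (SymmetricAlgebra k (PositiveWitt k)))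
    (hrad : ∀ n, (I n).IsRadical) (hpoisson : ∀ n, (I n).IsPoisson k)
    (hmono : ∀ n, I n ≤ I (n + 1)) :
    ∃ N, ∀ n, N ≤ n → I n = I N := by
  exact exists_forall_eq_of_isPoissonRadicalFG (fun _ => PositiveWitt.isPoissonRadicalFG)
    (monotone_nat_of_le_succ hmono) hrad hpoisson
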